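/- Let $p$ be a prime and $\mathcal{A} = \mathbb{F}_p[T]$. Let $\mathcal{M}$ be the set of monic polynomials in $\mathcal{A}$ and $\mathcal{M}_n$ the set of those of degree $n$. For $N \in \mathcal{M}$ let $d(N) := |\{(E,F) \in \mathcal{M}^2 : EF = N\}|$. For $A \in \mathcal{M}_n$ and an integer $0 \le h \le n$ put $$I(A;h) := \{B \in \mathcal{M} : \deg(B-A) < h\} \quad (\deg 0 = -\infty), \qquad \Delta(A;h) := \sum_{B \in I(A;h)} d(B) - p^h (n+1).$$ Then for all integers $n \ge 4$ and $0 \le h \le n$, $$\frac{1}{p^n} \sum_{A \in \mathcal{M}_n} |\Delta(A;h)|^2 = \begin{cases} (p-1)\,p^{h-1}\,\dfrac{(n-2h-1)(n-2h)(n-2h+1)}{6} & \text{if } h \le \lfloor n/2 \rfloor - 1, \\ 0 & \text{if } h \ge \lfloor n/2 \rfloor. \end{cases}$$ -/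

import Mathlib

open Polynomial

/-- The set `𝓜_n` of monic polynomials of degree `n` over `𝔽_p`. -/
def monicsOfDegree (p n : ℕ) : Set (ZMod p)[X] :=
  {A | A.Monic ∧ A.natDegree = n}

/-- The interval `I(A;h) = {B monic : deg (B - A) < h}`; here `deg 0 = -∞`
(this is `⊥` for `Polynomial.degree`), so `A ∈ I(A;h)` for every monic `A` and every `h ≥ 0`. -/
def shortInterval (p : ℕ) (A : (ZMod p)[X]) (h : ℕ) : Set (ZMod p)[X] :=
  {B | B.Monic ∧ (B - A).degree < (h : WithBot ℕ)}

/-- The ordered factorizations `N = E * F` into two monic polynomials. -/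
def monicFactorizations (p : ℕ) (N : (ZMod p)[X]) : Set ((ZMod p)[X] × (ZMod p)[X]) :=
  {EF | EF.1.Monic ∧ EF.2.Monic ∧ EF.1 * EF.2 = N}

/-- The divisor function `d(N) = d_2(N)`, the number of pairs `(E, F)` of monic polynomials
with `E F = N`. -/
noncomputable def divisorFunction (p : ℕ) (N : (ZMod p)[X]) : ℕ :=
  (monicFactorizations p N).ncard

/-- `𝓝_d(A;h) = ∑_{B ∈ I(A;h)} d(B)`. -/
noncomputable def intervalDivisorSum (p : ℕ) (A : (ZMod p)[X]) (h : ℕ) : ℕ :=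
  ∑ᶠ B ∈ shortInterval p A h, divisorFunction p B

/-- `Δ(A;h) = 𝓝_d(A;h) - p^h (n + 1)`, where `n = deg A`. -/
noncomputable def intervalDelta (p : ℕ) (A : (ZMod p)[X]) (h : ℕ) : ℝ :=
  (intervalDivisorSum p A h : ℝ) - (p : ℝ) ^ h * ((A.natDegree : ℝ) + 1)

/-- The variance `p^{-n} ∑_{A ∈ 𝓜_n} |Δ(A;h)|²`. -/
noncomputable def divisorVariance (p n h : ℕ) : ℝ :=
  1 / (p : ℝ) ^ n * ∑ᶠ A ∈ monicsOfDegree p n, |intervalDelta p A h| ^ 2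

/-! The sets summed over or counted above are finite, so no `finsum` or `ncard` is degenerate. -/

theorem finite_setOf_degree_lt (p : ℕ) [Fact p.Prime] (n : ℕ) :
    {A : (ZMod p)[X] | A.degree < (n : WithBot ℕ)}.Finite := by
  have : Finite (degreeLT (ZMod p) n) :=
    Finite.of_equiv _ (degreeLTEquiv (ZMod p) n).symm.toEquiv
  refine (Set.toFinite ((degreeLT (ZMod p) n : Set (ZMod p)[X]))).subset ?_
  intro A hA
  exact mem_degreeLT.2 hA

theorem finite_monicsOfDegree (p : ℕ) [Fact p.Prime] (n : ℕ) :
    (monicsOfDegree p n).Finite := by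
  refine (finite_setOf_degree_lt p (n + 1)).subset ?_
  rintro A ⟨_, hA⟩
  exact degree_le_natDegree.trans_lt (by rw [hA]; exact_mod_cast n.lt_succ_self)

theorem finite_shortInterval (p : ℕ) [Fact p.Prime] (A : (ZMod p)[X]) (h : ℕ) :
    (shortInterval p A h).Finite := by
  refine ((finite_setOf_degree_lt p h).image (fun C => C + A)).subset ?_
  rintro B ⟨_, hB⟩
  exact ⟨B - A, hB, by simp⟩

theorem finite_monicFactorizations (p : ℕ) [Fact p.Prime] (N : (ZMod p)[X]) :
    (monicFactorizations p N).Finite := by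
  have hf := finite_setOf_degree_lt p (N.natDegree + 1)
  refine (hf.prod hf).subset ?_
  rintro ⟨E, F⟩ ⟨hE, hF, hEF⟩
  have hd : N.natDegree = E.natDegree + F.natDegree := by
    rw [← hEF]; exact hE.natDegree_mul hF
  have hE' : E.natDegree < N.natDegree + 1 := by omega
  have hF' : F.natDegree < N.natDegree + 1 := by omega
  exact ⟨degree_le_natDegree.trans_lt (by exact_mod_cast hE'),
    degree_le_natDegree.trans_lt (by exact_mod_cast hF')⟩

/-!
Write `N_e(A)` for the number of pairs `(E, F)` of monic polynomials with `deg E = e`,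
`deg F = n - e` and `deg (E F - A) < h` (`factorCount`). Then `Δ(A;h) = ∑_{e ≤ n} (N_e(A) - p ^ h)`,
and `p ^ h` is the average of `N_e` over `A`, so the variance is the sum over `e, f ≤ n` of the
covariances of `N_e` and `N_f`. The point is that each covariance is explicit:
`cov(N_e, N_f) = (p - 1) p ^ (h - 1) (min(e, n - e, f, n - f) - h)₊` (`covariance`).

Since `N_e = N_{n-e}` (`factorCount_symm`), it may be assumed that `2 e ≤ n` and `2 f ≤ n`; this is
what makes the count below uniform, because then `e + f ≤ n`. Summing `N_e N_f` over `A` counts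
quadruples `(E, F, E', F')` with `deg (E F - E' F') < h`. Fix `E` and `E'`, and let `g` be the degree
of their gcd. The admissible differences `E F - E' F'` are the multiples of the gcd of degree below
`h`, and each of them fixes `F` in one residue class modulo a polynomial of degree
`f - g ≤ n - e`. Hence there are exactly `p ^ (n - e - f + max g h)` pairs `(F, F')`
(`card_cofactors`). It remains to average `p ^ max g h` over `E` and `E'`. Splitting off the gcd
gives a recursion in `(e, f)` for such averages (`sum_gcdDegree_succ`), in which the number of
coprime pairs is found by taking the constant function `1`; the average is
`p ^ h + (min e f - h)₊ (1 - 1 / p)` (`sum_pow_max_gcdDegree`).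

Finally `∑_{e, f ≤ n} (min(e, n - e, f, n - f) - h)₊` is the binomial coefficient
`(n - 2 h + 1).choose 3` for `2 h ≤ n`, by removing the outermost terms in steps of two
(`sum_min_fold_sub`, `sum_min_fold`), and every term vanishes for `h ≥ ⌊n / 2⌋`.
-/

/-! ### Monic polynomials of given degree -/

section
variable (p : ℕ) [Fact p.Prime]

/-- The monic polynomials of degree `n` over `ZMod p`, as a finset. -/
noncomputable def monics (n : ℕ) : Finset (ZMod p)[X] :=
  (finite_monicsOfDegree p n).toFinset

/-- The polynomials of degree less than `n` over `ZMod p`, as a finset; `degLT p 0 = {0}`. -/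
noncomputable def degLT (n : ℕ) : Finset (ZMod p)[X] :=
  (finite_setOf_degree_lt p n).toFinset

variable {p}

@[simp]
theorem mem_monics {n : ℕ} {A : (ZMod p)[X]} :
    A ∈ monics p n ↔ A.Monic ∧ A.natDegree = n := by
  simp [monics, monicsOfDegree]

@[simp]
theorem mem_degLT {n : ℕ} {A : (ZMod p)[X]} :
    A ∈ degLT p n ↔ A.degree < (n : WithBot ℕ) := by
  simp [degLT]

theorem card_degLT (n : ℕ) : (degLT p n).card = p ^ n := by
  have h1 : (degLT p n).card = Nat.card (degreeLT (ZMod p) n) := by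
    rw [degLT, ← Nat.card_eq_card_finite_toFinset]
    exact Nat.card_congr (Equiv.subtypeEquivRight fun A => by simp [mem_degreeLT])
  rw [h1, Nat.card_congr (degreeLTEquiv (ZMod p) n).toEquiv]
  simp [Nat.card_eq_fintype_card, ZMod.card]

/-- A perturbation of degree below `h ≤ n` keeps a polynomial monic of degree `n`, so elements of a
short interval need no separate check. -/
theorem monic_and_natDegree_of_sub {n h : ℕ} {A B : (ZMod p)[X]} (hA : A.Monic)
    (hn : A.natDegree = n) (hh : h ≤ n) (hB : (B - A).degree < (h : WithBot ℕ)) :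
    B.Monic ∧ B.natDegree = n := by
  have hd : (B - A).degree < A.degree := by
    rw [degree_eq_natDegree hA.ne_zero, hn]
    exact hB.trans_le (by exact_mod_cast hh)
  have hBA : B = A + (B - A) := by ring
  rw [hBA]
  refine ⟨hA.add_of_left hd, ?_⟩
  rw [natDegree_add_eq_left_of_degree_lt hd, hn]

theorem degree_sub_lt_of_mem_monics {n : ℕ} {A B : (ZMod p)[X]} (hA : A ∈ monics p n)
    (hB : B ∈ monics p n) : (A - B).degree < (n : WithBot ℕ) := by
  rw [mem_monics] at hA hB
  have hdA : A.degree = n := by rw [degree_eq_natDegree hA.1.ne_zero, hA.2]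
  have hdB : B.degree = n := by rw [degree_eq_natDegree hB.1.ne_zero, hB.2]
  rw [← hdA]
  exact degree_sub_lt_left (hdA.trans hdB.symm) hA.1.ne_zero
    (by rw [hA.1.leadingCoeff, hB.1.leadingCoeff])

open Classical in
theorem card_monics_degree_sub_lt {n h : ℕ} (hh : h ≤ n) {A : (ZMod p)[X]} (hA : A ∈ monics p n) :
    ((monics p n).filter fun B => (B - A).degree < (h : WithBot ℕ)).card = p ^ h := by
  rw [← card_degLT (p := p) h]
  rw [mem_monics] at hA
  refine Finset.card_nbij' (fun B => B - A) (fun C => C + A) ?_ ?_ ?_ ?_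
  · intro B hB
    simpa using (Finset.mem_filter.1 hB).2
  · intro C hC
    have hC' : (C + A - A).degree < (h : WithBot ℕ) := by simpa using hC
    simpa using ⟨monic_and_natDegree_of_sub hA.1 hA.2 hh hC', by simpa using hC'⟩
  · intro B _; simp
  · intro C _; simp

theorem card_monics (n : ℕ) : (monics p n).card = p ^ n := by
  classical
  have hX : (X ^ n : (ZMod p)[X]) ∈ monics p n := by simp [monic_X_pow]
  rw [← card_monics_degree_sub_lt le_rfl hX, Finset.filter_true_of_mem]
  exact fun B hB => degree_sub_lt_of_mem_monics hB hX

theorem mul_mem_monics {a b n : ℕ} (hn : a + b = n) {A B : (ZMod p)[X]} (hA : A ∈ monics p a)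
    (hB : B ∈ monics p b) : A * B ∈ monics p n := by
  rw [mem_monics] at *
  exact ⟨hA.1.mul hB.1, by rw [hA.1.natDegree_mul hB.1, hA.2, hB.2, hn]⟩

theorem mem_monics_of_mul_right {a b : ℕ} {A B : (ZMod p)[X]} (hA : A ∈ monics p a)
    (hAB : A * B ∈ monics p (a + b)) : B ∈ monics p b := by
  rw [mem_monics] at *
  have hB := hA.1.of_mul_monic_left hAB.1
  refine ⟨hB, ?_⟩
  have := hA.1.natDegree_mul hB
  omega

open Classical in
/-- For a monic `V` of degree `v ≤ N`, each residue class modulo `V` contains exactly `p ^ (N - v)`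
monic polynomials of degree `N`; they are the `V * t + (Y %ₘ V)` with `t` monic of degree `N - v`. -/
theorem card_monics_congr {N v : ℕ} (hv : v ≤ N) {V : (ZMod p)[X]} (hV : V ∈ monics p v)
    (Y : (ZMod p)[X]) : ((monics p N).filter fun F => V ∣ F - Y).card = p ^ (N - v) := by
  have hVm := (mem_monics.1 hV).1
  rw [← card_monics (p := p) (N - v)]
  have hR : (Y %ₘ V).degree < (v : WithBot ℕ) := by
    have := degree_modByMonic_lt Y hVm
    rwa [degree_eq_natDegree hVm.ne_zero, (mem_monics.1 hV).2] at this
  have hdvd : ∀ F : (ZMod p)[X], V ∣ F - Y ↔ V * (F /ₘ V) = F - Y %ₘ V := by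
    intro F
    rw [← modByMonic_eq_zero_iff_dvd hVm, sub_modByMonic]
    have := modByMonic_add_div F V
    constructor
    · intro h; linear_combination this - h
    · intro h; linear_combination this - h
  refine Finset.card_nbij' (fun F => F /ₘ V) (fun t => V * t + Y %ₘ V) ?_ ?_ ?_ ?_
  · intro F hF
    obtain ⟨hF, hd⟩ := Finset.mem_filter.1 hF
    rw [hdvd] at hd
    have h1 := mem_monics.1 hF
    refine mem_monics_of_mul_right hV ?_
    rw [hd, Nat.add_sub_cancel' hv, mem_monics]
    refine monic_and_natDegree_of_sub h1.1 h1.2 hv ?_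
    simpa using hR
  · intro t ht
    have h1 := mem_monics.1 (mul_mem_monics (Nat.add_sub_cancel' hv) hV ht)
    rw [Finset.coe_filter, Set.mem_ofPred_eq, mem_monics]
    refine ⟨monic_and_natDegree_of_sub h1.1 h1.2 hv (by simpa using hR), ?_⟩
    refine ⟨t - Y /ₘ V, ?_⟩
    have := modByMonic_add_div Y V
    linear_combination this
  · intro F hF
    have := (hdvd F).1 (Finset.mem_filter.1 hF).2
    simp only [this]; ring
  · intro t _
    have h2 := (div_modByMonic_unique (f := V * t + Y %ₘ V) t (Y %ₘ V) hVm
      ⟨by ring, degree_modByMonic_lt Y hVm⟩).1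
    exact h2

/-! ### Short differences of multiples of coprime polynomials -/

/-- The truncated subtraction is harmless: for `h ≤ g` both sides say `r = 0`. -/
theorem degree_mul_lt_iff {g h : ℕ} {G r : (ZMod p)[X]} (hG : G ∈ monics p g) :
    (G * r).degree < (h : WithBot ℕ) ↔ r.degree < ((h - g : ℕ) : WithBot ℕ) := by
  rw [mem_monics] at hG
  by_cases hr : r = 0
  · simp [hr]
  rw [degree_mul, degree_eq_natDegree hG.1.ne_zero, degree_eq_natDegree hr, hG.2, ← Nat.cast_add,
    Nat.cast_lt, Nat.cast_lt]
  omega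

open Classical in
/-- For coprime `U` and `V`, choose first the difference `r = U * F - V * F'`, with `p ^ h`
possibilities, and then `F` in the residue class modulo `V` that `r` prescribes. The polynomial `F'`
is determined by these and is automatically monic of the right degree. -/
theorem card_pairs_coprime {n g u v h : ℕ} {U V : (ZMod p)[X]} (hU : U ∈ monics p u)
    (hV : V ∈ monics p v) (huv : IsCoprime U V) (hn : u + v + g ≤ n) (hh : h + g ≤ n) :
    ((monics p (n - g - u) ×ˢ monics p (n - g - v)).filter
      fun x => (U * x.1 - V * x.2).degree < (h : WithBot ℕ)).card = p ^ (n - g - u - v + h) := by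
  have hVm := (mem_monics.1 hV).1
  have key : ((monics p (n - g - u) ×ˢ monics p (n - g - v)).filter
      fun x => (U * x.1 - V * x.2).degree < (h : WithBot ℕ)).card =
      ((degLT p h).sigma fun r => (monics p (n - g - u)).filter fun F => V ∣ U * F - r).card := by
    refine Finset.card_nbij' (fun x => ⟨U * x.1 - V * x.2, x.1⟩)
      (fun y => (y.2, (U * y.2 - y.1) /ₘ V)) ?_ ?_ ?_ ?_
    · rintro ⟨F, F'⟩ hx
      simp only [Finset.coe_filter, Finset.mem_product, Set.mem_ofPred_eq] at hx
      simp only [Finset.coe_sigma, Set.mem_sigma_iff, Finset.mem_coe, mem_degLT, Finset.mem_filter]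
      exact ⟨hx.2, hx.1.1, F', by ring⟩
    · rintro ⟨r, F⟩ hy
      simp only [Finset.coe_sigma, Set.mem_sigma_iff, Finset.mem_coe, mem_degLT,
        Finset.mem_filter] at hy
      obtain ⟨hr, hF, F', hF'⟩ := hy
      have hq : (U * F - r) /ₘ V = F' := by rw [hF', mul_divByMonic_cancel_left _ hVm]
      simp only [Finset.coe_filter, Finset.mem_product, Set.mem_ofPred_eq, hq]
      have h1 := mem_monics.1 (mul_mem_monics (n := n - g) (by omega) hU hF)
      refine ⟨⟨hF, mem_monics_of_mul_right hV ?_⟩, ?_⟩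
      · rw [← hF', show v + (n - g - v) = n - g by omega, mem_monics]
        exact monic_and_natDegree_of_sub h1.1 h1.2 (h := h) (by omega) (by simpa using hr)
      · rw [← hF']; simpa using hr
    · rintro ⟨F, F'⟩ _
      simp [mul_divByMonic_cancel_left _ hVm]
    · rintro ⟨r, F⟩ hy
      simp only [Finset.coe_sigma, Set.mem_sigma_iff, Finset.mem_coe, mem_degLT,
        Finset.mem_filter] at hy
      obtain ⟨hr, hF, F', hF'⟩ := hy
      have hq : (U * F - r) /ₘ V = F' := by rw [hF', mul_divByMonic_cancel_left _ hVm]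
      simp only [hq, ← hF']
      simp
  obtain ⟨a, b, hab⟩ := huv
  rw [key, Finset.card_sigma]
  -- With `a U + b V = 1`, the condition `V ∣ U F - r` says that `F ≡ a r` modulo `V`.
  have hfib : ∀ r ∈ degLT p h, ((monics p (n - g - u)).filter fun F => V ∣ U * F - r).card =
      p ^ (n - g - u - v) := by
    intro r _
    rw [← card_monics_congr (N := n - g - u) (v := v) (by omega) hV (a * r)]
    congr 1
    refine Finset.filter_congr fun F _ => ?_
    constructor
    · rintro ⟨c, hc⟩
      exact ⟨a * c + b * F, by linear_combination a * hc - F * hab⟩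
    · rintro ⟨c, hc⟩
      exact ⟨U * c - b * r, by linear_combination U * hc + r * hab⟩
  rw [Finset.sum_congr rfl hfib, Finset.sum_const, card_degLT, smul_eq_mul, pow_add, mul_comm]

/-! ### Distribution of the degree of the gcd -/

open Classical in
/-- The degree of the greatest common divisor. The Euclidean gcd is not normalized, but its degree
does not depend on the choice of an associate. -/
noncomputable def gcdDegree (E E' : (ZMod p)[X]) : ℕ :=
  (EuclideanDomain.gcd E E').natDegree

theorem gcdDegree_mul_of_coprime {g : ℕ} {G U V : (ZMod p)[X]} (hG : G ∈ monics p g)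
    (hUV : IsCoprime U V) : gcdDegree (G * U) (G * V) = g := by
  classical
  have h : Associated (EuclideanDomain.gcd (G * U) (G * V)) G := by
    refine associated_of_dvd_dvd ?_ (EuclideanDomain.dvd_gcd (Dvd.intro _ rfl) (Dvd.intro _ rfl))
    obtain ⟨a, b, hab⟩ := hUV
    have h1 := (EuclideanDomain.gcd_dvd_left (G * U) (G * V)).mul_left a
    have h2 := (EuclideanDomain.gcd_dvd_right (G * U) (G * V)).mul_left b
    have h3 : G = a * (G * U) + b * (G * V) := by linear_combination (-G) * hab
    exact (dvd_add h1 h2).trans (dvd_of_eq h3.symm)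
  rw [gcdDegree, natDegree_eq_of_degree_eq (degree_eq_degree_of_associated h),
    (mem_monics.1 hG).2]

/-- Splitting off the monic gcd of two monic polynomials. -/
theorem exists_coprime_parts {e f : ℕ} {E E' : (ZMod p)[X]} (hE : E ∈ monics p e)
    (hE' : E' ∈ monics p f) : ∃ g ≤ min e f, ∃ G ∈ monics p g, ∃ U ∈ monics p (e - g),
      ∃ V ∈ monics p (f - g), IsCoprime U V ∧ E = G * U ∧ E' = G * V := by
  classical
  have hE0 := (mem_monics.1 hE).1.ne_zero
  set D := EuclideanDomain.gcd E E' with hD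
  have hD0 : D ≠ 0 := fun h => hE0 (EuclideanDomain.gcd_eq_zero_iff.1 h).1
  have ha : Associated (normalize D) D := normalize_associated D
  have hG : (normalize D).Monic := monic_normalize hD0
  obtain ⟨U, hU⟩ : normalize D ∣ E := ha.dvd.trans (EuclideanDomain.gcd_dvd_left E E')
  obtain ⟨V, hV⟩ : normalize D ∣ E' := ha.dvd.trans (EuclideanDomain.gcd_dvd_right E E')
  have hGm : normalize D ∈ monics p (normalize D).natDegree := by simp [hG]
  have hUm : U.Monic := hG.of_mul_monic_left (hU ▸ (mem_monics.1 hE).1)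
  have hVm : V.Monic := hG.of_mul_monic_left (hV ▸ (mem_monics.1 hE').1)
  have hUd := hG.natDegree_mul hUm
  have hVd := hG.natDegree_mul hVm
  rw [← hU, (mem_monics.1 hE).2] at hUd
  rw [← hV, (mem_monics.1 hE').2] at hVd
  refine ⟨_, le_min (by omega) (by omega), _, hGm, U, mem_monics.2 ⟨hUm, by omega⟩, V,
    mem_monics.2 ⟨hVm, by omega⟩, ?_, hU, hV⟩
  have hb := EuclideanDomain.gcd_eq_gcd_ab E E'
  obtain ⟨c, hc⟩ := ha.symm.dvd
  refine ⟨c * EuclideanDomain.gcdA E E', c * EuclideanDomain.gcdB E E',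
    mul_left_cancel₀ hG.ne_zero ?_⟩
  linear_combination -hc - c * hb - c * EuclideanDomain.gcdA E E' * hU
    - c * EuclideanDomain.gcdB E E' * hV

open Classical in
/-- The pairs of coprime monic polynomials of degrees `a` and `b`. -/
noncomputable def coprimePairs (p a b : ℕ) [Fact p.Prime] : Finset ((ZMod p)[X] × (ZMod p)[X]) :=
  (monics p a ×ˢ monics p b).filter fun x => IsCoprime x.1 x.2

/-- Sorting pairs by their monic gcd `G`: a pair `(E, E')` with gcd of degree `g` is `(G * U, G * V)`
for a unique monic `G` of degree `g` and a unique coprime pair `(U, V)`. -/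
theorem sum_gcdDegree (e f : ℕ) (φ : ℕ → ℕ) :
    ∑ x ∈ monics p e ×ˢ monics p f, φ (gcdDegree x.1 x.2) =
      ∑ g ∈ Finset.range (min e f + 1), p ^ g * (coprimePairs p (e - g) (f - g)).card * φ g := by
  classical
  have h1 : ∀ g ∈ Finset.range (min e f + 1),
      p ^ g * (coprimePairs p (e - g) (f - g)).card * φ g =
        ∑ _y ∈ monics p g ×ˢ coprimePairs p (e - g) (f - g), φ g := by
    intro g _
    rw [Finset.sum_const, Finset.card_product, card_monics, smul_eq_mul]
  rw [Finset.sum_congr rfl h1, Finset.sum_sigma']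
  symm
  refine Finset.sum_bij (fun y _ => (y.2.1 * y.2.2.1, y.2.1 * y.2.2.2)) ?_ ?_ ?_ ?_
  · rintro ⟨g, G, U, V⟩ hy
    simp only [Finset.mem_sigma, Finset.mem_range, Finset.mem_product, coprimePairs,
      Finset.mem_filter] at hy ⊢
    exact ⟨mul_mem_monics (by omega) hy.2.1 hy.2.2.1.1, mul_mem_monics (by omega) hy.2.1 hy.2.2.1.2⟩
  · rintro ⟨g, G, U, V⟩ hy ⟨g', G', U', V'⟩ hy' heq
    simp only [Finset.mem_sigma, Finset.mem_range, Finset.mem_product, coprimePairs,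
      Finset.mem_filter, Prod.mk.injEq] at hy hy' heq
    -- A combination `a U' + b V' = 1` writes `G'` as a multiple of `G`.
    have hdvd : ∀ {G G' U U' V V' : (ZMod p)[X]}, IsCoprime U' V' → G * U = G' * U' →
        G * V = G' * V' → G ∣ G' := by
      rintro G G' U U' V V' ⟨a, b, hab⟩ h1 h2
      exact ⟨a * U + b * V, by linear_combination -G' * hab - a * h1 - b * h2⟩
    have hGG : G = G' := eq_of_monic_of_associated (mem_monics.1 hy.2.1).1 (mem_monics.1 hy'.2.1).1
      (associated_of_dvd_dvd (hdvd hy'.2.2.2 heq.1 heq.2) (hdvd hy.2.2.2 heq.1.symm heq.2.symm))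
    subst hGG
    have hG0 := (mem_monics.1 hy.2.1).1.ne_zero
    have hgg : g = g' := by rw [← (mem_monics.1 hy.2.1).2, ← (mem_monics.1 hy'.2.1).2]
    subst hgg
    rw [mul_left_cancel₀ hG0 heq.1, mul_left_cancel₀ hG0 heq.2]
  · rintro ⟨E, E'⟩ hx
    rw [Finset.mem_product] at hx
    obtain ⟨g, hg, G, hG, U, hU, V, hV, hUV, rfl, rfl⟩ := exists_coprime_parts hx.1 hx.2
    refine ⟨⟨g, G, U, V⟩, ?_, rfl⟩
    simp only [Finset.mem_sigma, Finset.mem_range, Finset.mem_product, coprimePairs,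
      Finset.mem_filter]
    exact ⟨by omega, hG, ⟨hU, hV⟩, hUV⟩
  · rintro ⟨g, G, U, V⟩ hy
    simp only [Finset.mem_sigma, Finset.mem_product, coprimePairs, Finset.mem_filter] at hy
    rw [gcdDegree_mul_of_coprime hy.2.1 hy.2.2.2]

/-- Pairs of degrees `(e + 1, f + 1)` with gcd of degree `g + 1` are `p` times as many as pairs of
degrees `(e, f)` with gcd of degree `g`, since only the number of possible gcds changes. -/
theorem sum_gcdDegree_succ (e f : ℕ) (φ : ℕ → ℕ) :
    ∑ x ∈ monics p (e + 1) ×ˢ monics p (f + 1), φ (gcdDegree x.1 x.2) =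
      (coprimePairs p (e + 1) (f + 1)).card * φ 0 +
        p * ∑ x ∈ monics p e ×ˢ monics p f, φ (gcdDegree x.1 x.2 + 1) := by
  rw [sum_gcdDegree, sum_gcdDegree e f fun g => φ (g + 1), Nat.succ_min_succ,
    Finset.sum_range_succ', Finset.mul_sum, add_comm]
  congr 1
  · simp
  · refine Finset.sum_congr rfl fun g _ => ?_
    rw [Nat.add_sub_add_right, Nat.add_sub_add_right]
    ring

theorem card_coprimePairs_succ (e f : ℕ) :
    (coprimePairs p (e + 1) (f + 1)).card + p ^ (e + f + 1) = p ^ (e + f + 2) := by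
  have h := sum_gcdDegree_succ (p := p) e f fun _ => 1
  simp only [Finset.sum_const, Finset.card_product, card_monics, smul_eq_mul, mul_one] at h
  rw [← pow_add, ← pow_add] at h
  rw [show e + f + 2 = e + 1 + (f + 1) by ring, h]
  ring

/-- The average of `p ^ max g h` over pairs of degrees `(e, f)`, `g` being the degree of the gcd, is
`p ^ h + (min e f - h) * (1 - 1 / p)`; denominators are cleared and the negative term moved to the
other side, so that the identity holds in `ℕ`. The subtraction `min e f - h` is meant truncated. -/
theorem sum_pow_max_gcdDegree (e f h : ℕ) :
    p * ∑ x ∈ monics p e ×ˢ monics p f, p ^ max (gcdDegree x.1 x.2) h + (min e f - h) * p ^ (e + f) =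
      p ^ (e + f) * (p ^ (h + 1) + (min e f - h) * p) := by
  -- When one degree is `0` the gcd is `1`, and `φ = 1` in `sum_gcdDegree` counts the pairs.
  have base : ∀ (e f h : ℕ), min e f = 0 →
      ∑ x ∈ monics p e ×ˢ monics p f, p ^ max (gcdDegree x.1 x.2) h = p ^ (e + f) * p ^ h := by
    intro e f h hm
    rw [sum_gcdDegree e f fun g => p ^ max g h]
    have h1 := sum_gcdDegree (p := p) e f fun _ => 1
    simp only [hm, zero_add, Finset.sum_range_one, Finset.sum_const, Finset.card_product,
      card_monics, smul_eq_mul, mul_one, Nat.zero_max] at h1 ⊢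
    rw [← h1, pow_add]
  induction e generalizing f h with
  | zero => rw [base 0 f h (by simp)]; simp; ring
  | succ e ih =>
    cases f with
    | zero => rw [base (e + 1) 0 h (by simp)]; simp; ring
    | succ f =>
      rw [sum_gcdDegree_succ e f fun g => p ^ max g h, Nat.succ_min_succ]
      have hc := card_coprimePairs_succ (p := p) e f
      cases h with
      | zero =>
        have := ih f 0
        simp only [Nat.max_zero, pow_zero, Nat.sub_zero, pow_succ, ← Finset.sum_mul] at this hc ⊢
        zify at *
        linear_combination p * hc + (p:ℤ)^2 * this
      | succ h =>
        have := ih f h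
        simp only [Nat.zero_max, Nat.add_max_add_right, Nat.add_sub_add_right, pow_succ,
          Nat.succ_eq_add_one, ← Finset.sum_mul] at this hc ⊢
        zify at *
        linear_combination p * p * (p:ℤ)^h * hc + (p:ℤ)^2 * this

/-! ### Factorizations with product in a short interval -/

open Classical in
/-- The number of pairs `(E, F)` of monic polynomials of degrees `e` and `n - e` whose product lies in
the interval of length `p ^ h` around `A`. It is used for `e ≤ n`, where `n - e` is not truncated. -/
noncomputable def factorCount (p : ℕ) [Fact p.Prime] (n h e : ℕ) (A : (ZMod p)[X]) : ℕ :=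
  ((monics p e ×ˢ monics p (n - e)).filter
    fun x => (x.1 * x.2 - A).degree < (h : WithBot ℕ)).card

theorem intervalDivisorSum_eq {n h : ℕ} (hh : h ≤ n) {A : (ZMod p)[X]} (hA : A ∈ monics p n) :
    intervalDivisorSum p A h = ∑ e ∈ Finset.range (n + 1), factorCount p n h e A := by
  classical
  have hI : ∀ {B : (ZMod p)[X]}, (B - A).degree < (h : WithBot ℕ) → B.natDegree = n := fun hB =>
    (monic_and_natDegree_of_sub (mem_monics.1 hA).1 (mem_monics.1 hA).2 hh hB).2
  rw [intervalDivisorSum, finsum_mem_eq_finite_toFinset_sum _ (finite_shortInterval p A h)]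
  simp only [divisorFunction, factorCount]
  rw [Finset.sum_congr rfl fun B _ => Set.ncard_eq_toFinset_card _ (finite_monicFactorizations p B),
    ← Finset.card_sigma, ← Finset.card_sigma]
  refine Finset.card_nbij' (fun y => ⟨y.2.1.natDegree, y.2⟩) (fun y => ⟨y.2.1 * y.2.2, y.2⟩)
    ?_ ?_ ?_ ?_
  · rintro ⟨B, E, F⟩ hy
    simp only [Finset.coe_sigma, Set.mem_sigma_iff, Finset.mem_coe, Set.Finite.mem_toFinset,
      shortInterval, monicFactorizations, Set.mem_ofPred_eq] at hy
    obtain ⟨⟨hB, hBA⟩, hE, hF, rfl⟩ := hy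
    have hd := hI hBA
    rw [hE.natDegree_mul hF] at hd
    simp only [Finset.coe_sigma, Set.mem_sigma_iff, Finset.mem_coe, Finset.mem_range,
      Finset.mem_filter, Finset.mem_product, mem_monics]
    exact ⟨by omega, ⟨⟨hE, trivial⟩, hF, by omega⟩, hBA⟩
  · rintro ⟨e, E, F⟩ hy
    simp only [Finset.coe_sigma, Set.mem_sigma_iff, Finset.mem_coe, Finset.mem_range,
      Finset.mem_filter, Finset.mem_product, mem_monics] at hy
    simp only [Finset.coe_sigma, Set.mem_sigma_iff, Finset.mem_coe, Set.Finite.mem_toFinset,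
      shortInterval, monicFactorizations, Set.mem_ofPred_eq]
    exact ⟨⟨hy.2.1.1.1.mul hy.2.1.2.1, hy.2.2⟩, hy.2.1.1.1, hy.2.1.2.1, trivial⟩
  · rintro ⟨B, E, F⟩ hy
    simp only [Finset.coe_sigma, Set.mem_sigma_iff, Finset.mem_coe, Set.Finite.mem_toFinset,
      monicFactorizations, Set.mem_ofPred_eq] at hy
    obtain ⟨-, -, -, rfl⟩ := hy
    rfl
  · rintro ⟨e, E, F⟩ hy
    simp only [Finset.coe_sigma, Set.mem_sigma_iff, Finset.mem_coe,
      Finset.mem_filter, Finset.mem_product, mem_monics] at hy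
    obtain ⟨-, ⟨⟨-, rfl⟩, -⟩, -⟩ := hy
    rfl

theorem factorCount_symm {n h e : ℕ} (he : e ≤ n) (A : (ZMod p)[X]) :
    factorCount p n h (n - e) A = factorCount p n h e A := by
  classical
  refine Finset.card_nbij' Prod.swap Prod.swap ?_ ?_ (fun x _ => x.swap_swap)
    (fun x _ => x.swap_swap)
  all_goals
    rintro ⟨E, F⟩ hx
    rw [Finset.coe_filter, Set.mem_ofPred_eq, Finset.mem_product, Nat.sub_sub_self he] at *
    exact ⟨hx.1.symm, by simpa [mul_comm] using hx.2⟩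

theorem degree_sub_comm (A B : (ZMod p)[X]) : (A - B).degree = (B - A).degree := by
  rw [← degree_neg, neg_sub]

open Classical in
theorem sum_factorCount {n h e : ℕ} (he : e ≤ n) (hh : h ≤ n) :
    ∑ A ∈ monics p n, factorCount p n h e A = p ^ (n + h) := by
  simp only [factorCount, Finset.card_filter]
  rw [Finset.sum_comm]
  have : ∀ x ∈ monics p e ×ˢ monics p (n - e), (∑ A ∈ monics p n,
      if (x.1 * x.2 - A).degree < (h : WithBot ℕ) then 1 else 0) = p ^ h := by
    intro x hx
    rw [Finset.mem_product] at hx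
    rw [← Finset.card_filter, ← card_monics_degree_sub_lt hh
      (mul_mem_monics (Nat.add_sub_cancel' he) hx.1 hx.2)]
    simp only [degree_sub_comm (x.1 * x.2)]
  rw [Finset.sum_congr rfl this, Finset.sum_const, Finset.card_product, card_monics, card_monics,
    ← pow_add, Nat.add_sub_cancel' he, smul_eq_mul, pow_add]

theorem degree_sub_lt_trans {h : ℕ} {A B C : (ZMod p)[X]}
    (hAB : (A - B).degree < (h : WithBot ℕ)) (hBC : (B - C).degree < (h : WithBot ℕ)) :
    (A - C).degree < (h : WithBot ℕ) := by
  rw [← sub_add_sub_cancel A B C]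
  exact (degree_add_le _ _).trans_lt (max_lt hAB hBC)

open Classical in
/-- Two products `E * F` and `E' * F'` lie in a common interval iff their difference has degree below
`h`, and then `p ^ h` polynomials `A` are centres of that interval. -/
theorem sum_factorCount_mul {n h e f : ℕ} (he : e ≤ n) (hh : h ≤ n) :
    ∑ A ∈ monics p n, factorCount p n h e A * factorCount p n h f A =
      p ^ h * ∑ x ∈ monics p e ×ˢ monics p f,
        ((monics p (n - e) ×ˢ monics p (n - f)).filter
          fun y => (x.1 * y.1 - x.2 * y.2).degree < (h : WithBot ℕ)).card := by
  have hin : ∀ P ∈ monics p n, ∀ Q : (ZMod p)[X], (∑ A ∈ monics p n,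
      (if (P - A).degree < (h : WithBot ℕ) then 1 else 0) *
        (if (Q - A).degree < (h : WithBot ℕ) then 1 else 0)) =
      p ^ h * if (P - Q).degree < (h : WithBot ℕ) then 1 else 0 := by
    intro P hP Q
    rw [← card_monics_degree_sub_lt hh hP, Finset.card_filter, Finset.sum_mul]
    refine Finset.sum_congr rfl fun A _ => ?_
    rw [degree_sub_comm A P]
    by_cases h1 : (P - A).degree < (h : WithBot ℕ)
    · have : (Q - A).degree < (h : WithBot ℕ) ↔ (P - Q).degree < (h : WithBot ℕ) := by
        constructor
        · intro h2
          rw [degree_sub_comm] at h2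
          exact degree_sub_lt_trans h1 h2
        · intro h2
          rw [degree_sub_comm] at h2
          exact degree_sub_lt_trans h2 h1
      simp only [this]
    · simp [h1]
  simp only [factorCount, Finset.card_filter, Finset.sum_mul_sum]
  simp only [Finset.sum_product, Finset.mul_sum]
  rw [Finset.sum_comm]
  refine Finset.sum_congr rfl fun E hE => ?_
  rw [Finset.sum_comm, Finset.sum_comm (s := monics p f)]
  refine Finset.sum_congr rfl fun F hF => ?_
  rw [Finset.sum_comm]
  refine Finset.sum_congr rfl fun E' _ => ?_
  rw [Finset.sum_comm]
  refine Finset.sum_congr rfl fun F' _ => ?_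
  exact hin _ (mul_mem_monics (Nat.add_sub_cancel' he) hE hF) _

open Classical in
/-- The condition `e + f ≤ n` ensures that `F`, of degree `n - e`, meets every residue class modulo
`E' / gcd(E, E')`, which has degree at most `f`. -/
theorem card_cofactors {n h e f : ℕ} (hef : e + f ≤ n) (hh : h ≤ n)
    {E E' : (ZMod p)[X]} (hE : E ∈ monics p e) (hE' : E' ∈ monics p f) :
    ((monics p (n - e) ×ˢ monics p (n - f)).filter
      fun y => (E * y.1 - E' * y.2).degree < (h : WithBot ℕ)).card =
      p ^ (n - e - f) * p ^ max (gcdDegree E E') h := by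
  obtain ⟨g, hg, G, hG, U, hU, V, hV, hUV, rfl, rfl⟩ := exists_coprime_parts hE hE'
  rw [gcdDegree_mul_of_coprime hG hUV]
  rw [le_min_iff] at hg
  simp only [mul_assoc, ← mul_sub, degree_mul_lt_iff hG]
  have := card_pairs_coprime (n := n) (g := g) (h := h - g) hU hV hUV (by omega) (by omega)
  rw [show n - g - (e - g) = n - e by omega, show n - g - (f - g) = n - f by omega] at this
  rw [this, ← pow_add]
  congr 1
  omega

/-! ### Covariances of the factor counts -/

theorem covariance_of_le {n h e f : ℕ} (he : 2 * e ≤ n) (hf : 2 * f ≤ n) (hh : h ≤ n) :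
    ∑ A ∈ monics p n, ((factorCount p n h e A : ℝ) - (p : ℝ) ^ h) *
        ((factorCount p n h f A : ℝ) - (p : ℝ) ^ h) =
      (p : ℝ) ^ n * (((p : ℝ) - 1) * (p : ℝ) ^ ((h : ℤ) - 1)) * ((min e f - h : ℕ) : ℝ) := by
  have hp : (p : ℝ) ≠ 0 := by exact_mod_cast (Fact.out : p.Prime).ne_zero
  have h1 := sum_factorCount (p := p) (e := e) (by omega) hh
  have h2 := sum_factorCount (p := p) (e := f) (by omega) hh
  have h3 := sum_factorCount_mul (p := p) (e := e) (f := f) (by omega) hh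
  have h4 := sum_pow_max_gcdDegree (p := p) e f h
  rw [Finset.sum_congr rfl fun x hx => card_cofactors (by omega) hh (Finset.mem_product.1 hx).1
    (Finset.mem_product.1 hx).2, ← Finset.mul_sum] at h3
  obtain ⟨m, rfl⟩ : ∃ m, n = e + f + m := ⟨n - e - f, by omega⟩
  rw [show e + f + m - e - f = m by omega] at h3
  have e1 : ∀ a b c : ℝ, (a - c) * (b - c) = a * b - c * a - c * b + c * c := by intros; ring
  simp only [e1, Finset.sum_add_distrib, Finset.sum_sub_distrib, ← Finset.mul_sum,
    Finset.sum_const, card_monics, nsmul_eq_mul]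
  have h1' := congrArg (Nat.cast : ℕ → ℝ) h1
  have h2' := congrArg (Nat.cast : ℕ → ℝ) h2
  have h3' := congrArg (Nat.cast : ℕ → ℝ) h3
  have h4' := congrArg (Nat.cast : ℕ → ℝ) h4
  push_cast at h1' h2' h3' h4' ⊢
  rw [h1', h2', h3', zpow_sub_one₀ hp, zpow_natCast]
  apply mul_left_cancel₀ hp
  field_simp
  simp only [pow_add] at h4' ⊢
  linear_combination (p : ℝ) ^ m * h4'

/-- The covariance of two factor counts. The folding `e ↦ min e (n - e)` reduces it to
`covariance_of_le`. -/
theorem covariance {n h e f : ℕ} (he : e ≤ n) (hf : f ≤ n) (hh : h ≤ n) :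
    ∑ A ∈ monics p n, ((factorCount p n h e A : ℝ) - (p : ℝ) ^ h) *
        ((factorCount p n h f A : ℝ) - (p : ℝ) ^ h) =
      (p : ℝ) ^ n * (((p : ℝ) - 1) * (p : ℝ) ^ ((h : ℤ) - 1)) *
        ((min (min e (n - e)) (min f (n - f)) - h : ℕ) : ℝ) := by
  have hfold : ∀ {e : ℕ}, e ≤ n → ∀ A : (ZMod p)[X],
      factorCount p n h (min e (n - e)) A = factorCount p n h e A := by
    intro e he A
    rcases min_choice e (n - e) with h1 | h1 <;> rw [h1]
    exact factorCount_symm he A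
  rw [← covariance_of_le (by omega) (by omega) hh]
  simp only [hfold he, hfold hf]

end

/-! ### The sum of the covariances -/

/-- The terms with `e` or `f` equal to `0` or `n + 2` vanish, and the remaining ones are shifted by
one. -/
theorem sum_min_fold_sub_add_two (n h : ℕ) :
    ∑ e ∈ Finset.range (n + 2 + 1), ∑ f ∈ Finset.range (n + 2 + 1),
        (min (min e (n + 2 - e)) (min f (n + 2 - f)) - h) =
      ∑ e ∈ Finset.range (n + 1), ∑ f ∈ Finset.range (n + 1),
        (1 + min (min e (n - e)) (min f (n - f)) - h) := by
  have hstep : ∀ F : ℕ → ℕ, F 0 = 0 → F (n + 2) = 0 →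
      ∑ e ∈ Finset.range (n + 2 + 1), F e = ∑ e ∈ Finset.range (n + 1), F (e + 1) := by
    intro F h0 h1
    rw [Finset.sum_range_succ, Finset.sum_range_succ', h0, h1, add_zero, add_zero]
  rw [hstep _ (by simp) (by simp)]
  refine Finset.sum_congr rfl fun e he => ?_
  rw [hstep _ (by simp) (by simp)]
  refine Finset.sum_congr rfl fun f hf => ?_
  rw [Finset.mem_range] at he hf
  omega

theorem sum_min_fold (n : ℕ) :
    6 * ∑ e ∈ Finset.range (n + 1), ∑ f ∈ Finset.range (n + 1),
        ((min (min e (n - e)) (min f (n - f)) : ℕ) : ℤ) = ((n : ℤ) - 1) * n * (n + 1) := by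
  induction n using Nat.twoStepInduction with
  | zero => simp
  | one => simp [Finset.sum_range_succ]
  | more n ih _ =>
    have h := sum_min_fold_sub_add_two n 0
    simp only [Nat.sub_zero, Finset.sum_add_distrib, Finset.sum_const, Finset.card_range,
      smul_eq_mul, mul_one] at h
    have h' := congrArg (Nat.cast : ℕ → ℤ) h
    push_cast at h' ih ⊢
    rw [h']
    linear_combination ih

theorem sum_min_fold_sub (m h : ℕ) :
    ∑ e ∈ Finset.range (m + 2 * h + 1), ∑ f ∈ Finset.range (m + 2 * h + 1),
        (min (min e (m + 2 * h - e)) (min f (m + 2 * h - f)) - h) =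
      ∑ e ∈ Finset.range (m + 1), ∑ f ∈ Finset.range (m + 1),
        min (min e (m - e)) (min f (m - f)) := by
  induction h with
  | zero => simp
  | succ h ih =>
    rw [← ih, show m + 2 * (h + 1) = m + 2 * h + 2 by ring, sum_min_fold_sub_add_two]
    refine Finset.sum_congr rfl fun e _ => Finset.sum_congr rfl fun f _ => ?_
    omega

/-! ### The variance of the divisor sum -/

theorem divisorVariance_eq {p : ℕ} [Fact p.Prime] {n h : ℕ} (hh : h ≤ n) :
    divisorVariance p n h = ((p : ℝ) - 1) * (p : ℝ) ^ ((h : ℤ) - 1) *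
      ∑ e ∈ Finset.range (n + 1), ∑ f ∈ Finset.range (n + 1),
        ((min (min e (n - e)) (min f (n - f)) - h : ℕ) : ℝ) := by
  have hp : (p : ℝ) ≠ 0 := by exact_mod_cast (Fact.out : p.Prime).ne_zero
  have hΔ : ∀ A ∈ monics p n, |intervalDelta p A h| ^ 2 =
      ∑ e ∈ Finset.range (n + 1), ∑ f ∈ Finset.range (n + 1),
        ((factorCount p n h e A : ℝ) - (p : ℝ) ^ h) *
          ((factorCount p n h f A : ℝ) - (p : ℝ) ^ h) := by
    intro A hA
    rw [← Finset.sum_mul_sum, ← sq, sq_abs, intervalDelta, intervalDivisorSum_eq hh hA,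
      (mem_monics.1 hA).2]
    simp [Finset.sum_sub_distrib]
    ring
  rw [divisorVariance, finsum_mem_eq_finite_toFinset_sum _ (finite_monicsOfDegree p n)]
  change 1 / (p : ℝ) ^ n * ∑ A ∈ monics p n, _ = _
  rw [Finset.sum_congr rfl hΔ, Finset.sum_comm, Finset.mul_sum, Finset.mul_sum]
  refine Finset.sum_congr rfl fun e he => ?_
  rw [Finset.sum_comm, Finset.mul_sum, Finset.mul_sum]
  refine Finset.sum_congr rfl fun f hf => ?_
  rw [Finset.mem_range] at he hf
  rw [covariance (by omega) (by omega) hh]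
  field_simp

theorem theorem1p1 (p : ℕ) [Fact p.Prime] (n h : ℕ) (hn : 4 ≤ n) (hh : h ≤ n) :
    (h ≤ n / 2 - 1 →
      divisorVariance p n h =
        ((p : ℝ) - 1) * (p : ℝ) ^ ((h : ℤ) - 1) *
          (((n : ℝ) - 2 * h - 1) * ((n : ℝ) - 2 * h) * ((n : ℝ) - 2 * h + 1) / 6)) ∧
    (n / 2 ≤ h → divisorVariance p n h = 0) := by
  rw [divisorVariance_eq hh]
  refine ⟨fun hlt => ?_, fun hle => ?_⟩
  · obtain ⟨m, rfl⟩ : ∃ m, n = m + 2 * h := ⟨n - 2 * h, by omega⟩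
    have h1 := congrArg (Nat.cast : ℕ → ℝ) (sum_min_fold_sub m h)
    have h2 := congrArg (Int.cast : ℤ → ℝ) (sum_min_fold m)
    push_cast at h1 h2 ⊢
    rw [h1]
    linear_combination ((p : ℝ) - 1) * (p : ℝ) ^ ((h : ℤ) - 1) * h2 / 6
  · rw [Finset.sum_eq_zero, mul_zero]
    refine fun e he => Finset.sum_eq_zero fun f hf => ?_
    rw [Finset.mem_range] at he hf
    rw [show min (min e (n - e)) (min f (n - f)) - h = 0 by omega, Nat.cast_zero]
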